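/- Let $D=\{(x,y)\in\mathbb R^2: x^2+y^2<1\}$ be the open unit disk and let $S^1$ be its boundary circle, identified with $\mathbb R/\mathbb Z$ so that increasing coordinates run counterclockwise. Let $\triangle PQR$ be a (non-degenerate) triangle contained in $D$. For each $v\in S^1$ there are exactly two points $u\in S^1$ such that the segment $vu$ is tangent to $\triangle PQR$ (that is, it meets the triangle but not its interior); let $\psi_{\triangle PQR}(v)$ be the one of them that is reached first when moving counterclockwise from $v$. The map $\psi_{\triangle PQR}:S^1\to S^1$ is a homeomorphism. Let $\overline{\psi_{\triangle PQR}}:\mathbb R\to\mathbb R$ be its lift with $\overline{\psi_{\triangle PQR}}(0)\in(0,1)$, and let $$\rho(\psi_{\triangle PQR})=\lim_{n\to\infty}\frac{\overline{\psi_{\triangle PQR}}^{\,n}(0)}{n}$$ be its rotation number. **Theorem.** For every (non-degenerate) triangle $\triangle PQR$ in $\mathbb R^2$ there exists a triangle $\triangle P'Q'R'\subset D$ similar to $\triangle PQR$ such that, for every triangle $\triangle ABC\subset D$ congruent to $\triangle P'Q'R'$, $$\rho(\psi_{\triangle ABC})=\tfrac13 .$$ Here similarity and congruence are in the sense of Euclidean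 geometry (reflections are allowed). -/

import Mathlib

noncomputable section

namespace BarBilliard

/-- The open unit disk `D` of the Euclidean plane, the plane being identified with `ℂ`. -/
def disk : Set ℂ := Metric.ball 0 1

/-- The triangle, with its inside and its sides, lies in the open unit disk. -/
def InDisk (T : Affine.Triangle ℝ ℂ) : Prop := T.closedInterior ⊆ disk

/-- The point of the unit circle with coordinate `v ∈ S¹ = ℝ/ℤ`, that is `exp (2πiv)`;
increasing `v` is the counterclockwise direction. -/
def circlePoint (v : UnitAddCircle) : ℂ := (AddCircle.toCircle v : ℂ)

/-- The segment joining the points `v`, `u` of the unit circle is tangent to the triangle `T`: it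
touches `T` without meeting the inside of `T`. -/
def IsTangentChord (T : Affine.Triangle ℝ ℂ) (v u : UnitAddCircle) : Prop :=
  (segment ℝ (circlePoint v) (circlePoint u) ∩ T.closedInterior).Nonempty ∧
    Disjoint (segment ℝ (circlePoint v) (circlePoint u)) T.interior

/-- The lengths `t ∈ (0,1)` (a full turn having length `1`) of the counterclockwise arcs from `v` to
the points `u` of the circle for which the segment `vu` is tangent to `T`. For a triangle in the
disk there are exactly two. -/
def tangentArcs (T : Affine.Triangle ℝ ℂ) (v : UnitAddCircle) : Set ℝ :=
  {t : ℝ | t ∈ Set.Ioo (0 : ℝ) 1 ∧ IsTangentChord T v (v + (t : UnitAddCircle))}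

/-- The bar billiard map `ψ_T` of `S¹`: it sends `v` to that of the two points `u` with `vu` tangent
to `T` which comes first when moving counterclockwise from `v`. -/
def psi (T : Affine.Triangle ℝ ℂ) (v : UnitAddCircle) : UnitAddCircle :=
  v + ((sInf (tangentArcs T v) : ℝ) : UnitAddCircle)

/-- `F` is the lift to `ℝ` of the self-map `f` of `S¹ = ℝ/ℤ` that is normalized by `F 0 ∈ (0,1)`. A
`CircleDeg1Lift` is a monotone map `F : ℝ → ℝ` with `F (x + 1) = F x + 1`. -/
def IsNormalizedLift (f : UnitAddCircle → UnitAddCircle) (F : CircleDeg1Lift) : Prop :=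
  Continuous F ∧ (∀ x : ℝ, ((F x : ℝ) : UnitAddCircle) = f (x : UnitAddCircle)) ∧
    F 0 ∈ Set.Ioo (0 : ℝ) 1

/-- There is at most one normalized lift. -/
theorem IsNormalizedLift.unique {f : UnitAddCircle → UnitAddCircle} {F G : CircleDeg1Lift}
    (hF : IsNormalizedLift f F) (hG : IsNormalizedLift f G) : F = G := by
  obtain ⟨hFc, hFf, hF0⟩ := hF
  obtain ⟨hGc, hGf, hG0⟩ := hG
  have hint : ∀ x : ℝ, ∃ n : ℤ, F x - G x = n := by
    intro x
    have h : ((F x - G x : ℝ) : UnitAddCircle) = 0 := by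
      rw [AddCircle.coe_sub, hFf, hGf, sub_self]
    obtain ⟨n, hn⟩ := (AddCircle.coe_eq_zero_iff (1 : ℝ)).1 h
    exact ⟨n, by simpa using hn.symm⟩
  choose n hn using hint
  have hcast : Continuous fun x : ℝ => ((n x : ℤ) : ℝ) := by
    have h : (fun x : ℝ => ((n x : ℤ) : ℝ)) = fun x => F x - G x := funext fun x => (hn x).symm
    rw [h]
    exact hFc.sub hGc
  have hnc : Continuous n := Int.isClosedEmbedding_coe_real.isEmbedding.continuous_iff.2 hcast
  have hn0 : n 0 = 0 := by
    have h := hn 0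
    have h1 : ((n 0 : ℤ) : ℝ) < 1 := by rw [← h]; linarith [hF0.2, hG0.1]
    have h2 : (-1 : ℝ) < ((n 0 : ℤ) : ℝ) := by rw [← h]; linarith [hF0.1, hG0.2]
    have h3 : n 0 < 1 := by exact_mod_cast h1
    have h4 : -1 < n 0 := by exact_mod_cast h2
    omega
  ext x
  have hx : n x = 0 := by rw [← hn0]; exact PreconnectedSpace.constant inferInstance hnc
  have h := hn x
  rw [hx] at h
  simpa [sub_eq_zero] using h

open Classical in
/-- The rotation number `ρ(f) = lim (Fⁿ 0) / n` of a self-map `f` of `S¹` with normalized lift `F`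
(and `0` by convention for maps `f` without such a lift). -/
def rotationNumber (f : UnitAddCircle → UnitAddCircle) : ℝ :=
  if h : ∃ F : CircleDeg1Lift, IsNormalizedLift f F then h.choose.translationNumber else 0

end BarBilliard

end

namespace BarBilliard

open Complex ComplexConjugate

/-! For a point `p` of the disk, sending a point of the circle to the other end of its chord through
`p` lifts to an increasing map of degree one, `chordMap p`. The lift of the billiard map is the
minimum of these maps over the three vertices. Its rotation number is tested against inscribed
triangles `XYZ`. If `XYZ` contains `T`, three steps from `X` advance at least one full turn, so the
number is at least 1/3 (`third_le_rotationNumber`). If every side of `XYZ` has a vertex of `T`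
weakly on its outer side, three steps advance at most one turn, so the number is at most 1/3
(`rotationNumber_le_third`).

The first test always succeeds: extend the longest side of `T` to a chord and take as apex the point
of the circle straight above the third vertex, whose foot lies on that side
(`third_le_of_foot_mem`).

The second test succeeds when `T` is large. If the smallest enclosing circle of `T` has radius `ρ`
and centre `o`, then `‖o‖² + ρ² < 1` (`sq_norm_center_lt`), so `ρ` near 1 forces that circle to be
near the unit circle. In the limiting position an explicit isosceles inscribed triangle passes the
test with strict margin (`chord_margin_pos`), hence so does every nearby position
(`le_third_of_near`). The margin depends only on the shape, so one size serves all congruent copies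
(`exists_radius`). -/

/-! ### Chords of the unit circle in angular coordinates -/

/-- Planar cross product of the vectors `z` and `w`. -/
def cross (z w : ℂ) : ℝ := z.re * w.im - z.im * w.re

/-- The point of the unit circle at angle `2πx`. -/
noncomputable abbrev unitPoint (x : ℝ) : ℂ := circlePoint (x : UnitAddCircle)

theorem unitPoint_eq_exp (x : ℝ) : unitPoint x = exp ((2 * Real.pi * x : ℝ) * I) := by
  simp [unitPoint, circlePoint, AddCircle.toCircle_apply_mk, Circle.coe_exp]

theorem unitPoint_re (x : ℝ) : (unitPoint x).re = Real.cos (2 * Real.pi * x) := by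
  rw [unitPoint_eq_exp, exp_ofReal_mul_I_re]

theorem unitPoint_im (x : ℝ) : (unitPoint x).im = Real.sin (2 * Real.pi * x) := by
  rw [unitPoint_eq_exp, exp_ofReal_mul_I_im]

theorem norm_unitPoint (x : ℝ) : ‖unitPoint x‖ = 1 := Circle.norm_coe _

theorem unitPoint_add_one (x : ℝ) : unitPoint (x + 1) = unitPoint x := by
  simp [unitPoint]

theorem continuous_unitPoint : Continuous unitPoint := by
  have : unitPoint = fun x : ℝ => exp ((2 * Real.pi * x : ℝ) * I) := funext unitPoint_eq_exp
  rw [this]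
  fun_prop

/-- A positive multiple of the signed distance of `p` to the left of the chord from `unitPoint x` to
`unitPoint y`, for `x < y < x + 1`. -/
noncomputable def side (p : ℂ) (x y : ℝ) : ℝ :=
  Real.cos (Real.pi * (y - x)) -
    (p.re * Real.cos (Real.pi * (x + y)) + p.im * Real.sin (Real.pi * (x + y)))

theorem side_comm (p : ℂ) (x y : ℝ) : side p x y = side p y x := by
  have : Real.pi * (y - x) = -(Real.pi * (x - y)) := by ring
  rw [side, side, this, Real.cos_neg, add_comm x y]

theorem cross_unitPoint (p : ℂ) (x y : ℝ) :
    cross (unitPoint y - unitPoint x) (p - unitPoint x) =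
      2 * Real.sin (Real.pi * (y - x)) * side p x y := by
  have h1 : 2 * Real.pi * y = Real.pi * (x + y) + Real.pi * (y - x) := by ring
  have h2 : 2 * Real.pi * x = Real.pi * (x + y) - Real.pi * (y - x) := by ring
  have := Real.sin_sq_add_cos_sq (Real.pi * (x + y))
  simp only [cross, side, sub_re, sub_im, unitPoint_re, unitPoint_im, h1, h2, Real.cos_add,
    Real.cos_sub, Real.sin_add, Real.sin_sub]
  linear_combination (2 * Real.sin (Real.pi * (y - x)) * Real.cos (Real.pi * (y - x))) * this

theorem side_unitPoint (x y z : ℝ) :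
    side (unitPoint z) x y = 2 * Real.sin (Real.pi * (z - x)) * Real.sin (Real.pi * (z - y)) := by
  have h1 : Real.pi * (y - x) = Real.pi * (z - x) - Real.pi * (z - y) := by ring
  have h2 : Real.pi * (x + y) = 2 * Real.pi * z - (Real.pi * (z - x) + Real.pi * (z - y)) := by
    ring
  have := Real.sin_sq_add_cos_sq (2 * Real.pi * z)
  rw [side, unitPoint_re, unitPoint_im, h1, h2, Real.cos_sub, Real.cos_sub, Real.sin_sub,
    Real.cos_add, Real.sin_add]
  linear_combination (-(Real.cos (Real.pi * (z - x)) * Real.cos (Real.pi * (z - y))) +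
    Real.sin (Real.pi * (z - x)) * Real.sin (Real.pi * (z - y))) * this

/-! ### The chord map of a point of the disk -/

/-- The second intersection of the unit circle with the line through `unitPoint x` and `p`, lifted
to the interval `(x, x + 1)`. -/
noncomputable def chordMap (p : ℂ) (x : ℝ) : ℝ := x + (1 / 2 + arg (1 - p * conj (unitPoint x)) / Real.pi)

section chordMap

variable {p : ℂ}

/-- `1 - p * conj (unitPoint x)` is `unitPoint x - p` in the frame where `unitPoint x` becomes 1.
Positive real part keeps its argument in (-π/2, π/2), where `arg` is continuous; this confines
`chordMap p x` to one turn. -/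
theorem re_one_sub_pos (hp : ‖p‖ < 1) (x : ℝ) : 0 < (1 - p * conj (unitPoint x)).re := by
  have h : (p * conj (unitPoint x)).re ≤ ‖p * conj (unitPoint x)‖ := re_le_norm _
  rw [norm_mul, RCLike.norm_conj, norm_unitPoint, mul_one] at h
  rw [sub_re, one_re]
  linarith

theorem continuous_chordMap (hp : ‖p‖ < 1) : Continuous (chordMap p) := by
  have h : Continuous fun x => arg (1 - p * conj (unitPoint x)) := by
    refine continuous_iff_continuousAt.2 fun x => ?_
    refine ContinuousAt.comp (f := fun x => 1 - p * conj (unitPoint x)) (g := arg)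
      (continuousAt_arg (Or.inl (re_one_sub_pos hp x))) ?_
    have := continuous_unitPoint
    exact (continuous_const.sub (continuous_const.mul (continuous_conj.comp this))).continuousAt
  unfold chordMap
  fun_prop

theorem chordMap_add_one (x : ℝ) : chordMap p (x + 1) = chordMap p x + 1 := by
  rw [chordMap, chordMap, unitPoint_add_one]
  ring

theorem chordMap_mem_Ioo (hp : ‖p‖ < 1) (x : ℝ) : chordMap p x ∈ Set.Ioo x (x + 1) := by
  have h := abs_lt.1 (abs_arg_lt_pi_div_two_iff.2 (Or.inl (re_one_sub_pos hp x)))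
  have hpi := Real.pi_pos
  have h1 : -(1 / 2) < arg (1 - p * conj (unitPoint x)) / Real.pi := by
    rw [lt_div_iff₀ hpi]; linarith
  have h2 : arg (1 - p * conj (unitPoint x)) / Real.pi < 1 / 2 := by
    rw [div_lt_iff₀ hpi]; linarith
  constructor <;> unfold chordMap <;> linarith

/-- As a function of `y`, `side` is a sine vanishing at `chordMap p x`, with positive amplitude when
`‖p‖ < 1`. Left-or-right questions about chords from `x` thus become comparisons of `y` with
`chordMap p x`. -/
theorem side_eq_norm_mul_sin (p : ℂ) (x y : ℝ) :
    side p x y = ‖1 - p * conj (unitPoint x)‖ * Real.sin (Real.pi * (chordMap p x - y)) := by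
  set ζ := 1 - p * conj (unitPoint x) with hζ
  have h1 : Real.pi * (chordMap p x - y) = arg ζ - Real.pi * (y - x) + Real.pi / 2 := by
    rw [chordMap, ← hζ]; field_simp; ring
  have h2 : Real.pi * (x + y) = 2 * Real.pi * x + Real.pi * (y - x) := by ring
  rw [h1, Real.sin_add_pi_div_two, Real.cos_sub, mul_add, ← mul_assoc, ← mul_assoc,
    norm_mul_cos_arg, norm_mul_sin_arg, side, h2, Real.cos_add, Real.sin_add]
  simp only [hζ, sub_re, sub_im, one_re, one_im, mul_re, mul_im, conj_re, conj_im, unitPoint_re,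
    unitPoint_im]
  ring

theorem norm_one_sub_pos (hp : ‖p‖ < 1) (x : ℝ) : 0 < ‖1 - p * conj (unitPoint x)‖ :=
  (re_one_sub_pos hp x).trans_le (re_le_norm _)

theorem side_pos_iff (hp : ‖p‖ < 1) {x y : ℝ} (hy : y ∈ Set.Ioo x (x + 1)) :
    0 < side p x y ↔ y < chordMap p x := by
  have hG := chordMap_mem_Ioo hp x
  have hpi := Real.pi_pos
  rw [side_eq_norm_mul_sin, mul_pos_iff_of_pos_left (norm_one_sub_pos hp x)]
  constructor
  · intro h
    by_contra! hle
    refine h.not_ge (Real.sin_nonpos_of_nonpos_of_neg_pi_le ?_ ?_)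
    · nlinarith
    · nlinarith [hG.1, hy.2]
  · intro h
    apply Real.sin_pos_of_pos_of_lt_pi
    · nlinarith
    · nlinarith [hG.2, hy.1]

theorem side_nonneg_iff (hp : ‖p‖ < 1) {x y : ℝ} (hy : y ∈ Set.Ioo x (x + 1)) :
    0 ≤ side p x y ↔ y ≤ chordMap p x := by
  have hG := chordMap_mem_Ioo hp x
  have hpi := Real.pi_pos
  rw [side_eq_norm_mul_sin, mul_nonneg_iff_of_pos_left (norm_one_sub_pos hp x)]
  constructor
  · intro h
    by_contra! hlt
    refine h.not_gt (Real.sin_neg_of_neg_of_neg_pi_lt ?_ ?_)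
    · nlinarith
    · nlinarith [hG.1, hy.2]
  · intro h
    apply Real.sin_nonneg_of_nonneg_of_le_pi
    · nlinarith
    · nlinarith [hG.2, hy.1]

theorem side_chordMap (p : ℂ) (x : ℝ) : side p x (chordMap p x) = 0 := by
  rw [side_eq_norm_mul_sin, sub_self, mul_zero, Real.sin_zero, mul_zero]

theorem chordMap_chordMap (hp : ‖p‖ < 1) (x : ℝ) : chordMap p (chordMap p x) = x + 1 := by
  have h := side_chordMap p x
  rw [side_comm, side_eq_norm_mul_sin, mul_eq_zero_iff_left (norm_one_sub_pos hp _).ne',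
    Real.sin_eq_zero_iff] at h
  obtain ⟨n, hn⟩ := h
  have hn' : (n : ℝ) = chordMap p (chordMap p x) - x := by
    rw [mul_comm] at hn
    exact mul_left_cancel₀ Real.pi_ne_zero hn
  have h1 := chordMap_mem_Ioo hp x
  have h2 := chordMap_mem_Ioo hp (chordMap p x)
  have h3 : (0 : ℝ) < n := by rw [hn']; linarith [h1.1, h2.1]
  have h4 : (n : ℝ) < 2 := by rw [hn']; linarith [h1.2, h2.2]
  have h5 : n = 1 := by
    have : 0 < n := by exact_mod_cast h3
    have : n < 2 := by exact_mod_cast h4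
    omega
  rw [h5] at hn'
  push_cast at hn'
  linarith

/-- Applying the map twice shifts by a full turn, which forces injectivity. A continuous injection
is strictly monotone, and degree one rules out decrease. -/
theorem strictMono_chordMap (hp : ‖p‖ < 1) : StrictMono (chordMap p) := by
  have hinj : Function.Injective (chordMap p) := fun x y h => by
    have h1 := chordMap_chordMap hp x
    rw [h, chordMap_chordMap hp y] at h1
    linarith
  refine ((continuous_chordMap hp).strictMono_of_inj hinj).resolve_right fun h => ?_
  have := h (show (0 : ℝ) < 0 + 1 by norm_num)
  rw [chordMap_add_one] at this
  linarith

end chordMap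

/-! ### Triangles against chords -/

theorem side_affine_combination (q : Fin 3 → ℂ) {w : Fin 3 → ℝ} (hw : ∑ i, w i = 1) (x y : ℝ) :
    side (∑ i, w i • q i) x y = ∑ i, w i * side (q i) x y := by
  simp only [Fin.sum_univ_three] at hw ⊢
  simp only [side, add_re, add_im, smul_re, smul_im, smul_eq_mul]
  linear_combination -Real.cos (Real.pi * (y - x)) * hw

theorem side_eq_zero_of_mem_segment {z : ℂ} {x y : ℝ}
    (hz : z ∈ segment ℝ (unitPoint x) (unitPoint y)) : side z x y = 0 := by
  obtain ⟨a, b, -, -, hab, rfl⟩ := hz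
  have h1 : side (unitPoint x) x y = 0 := by simp [side_unitPoint]
  have h2 : side (unitPoint y) x y = 0 := by simp [side_unitPoint]
  have : side (a • unitPoint x + b • unitPoint y) x y =
      a * side (unitPoint x) x y + b * side (unitPoint y) x y := by
    simp only [side, add_re, add_im, smul_re, smul_im, smul_eq_mul]
    linear_combination -Real.cos (Real.pi * (y - x)) * hab
  rw [this, h1, h2]
  simp

/-- A point of the disk on the line through two points of the circle lies between them. -/
theorem mem_segment_of_side_eq_zero {p : ℂ} (hp : ‖p‖ < 1) {x y : ℝ}
    (hy : y ∈ Set.Ioo x (x + 1)) (h : side p x y = 0) :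
    p ∈ segment ℝ (unitPoint x) (unitPoint y) := by
  have hpi := Real.pi_pos
  have hs : 0 < Real.sin (Real.pi * (y - x)) :=
    Real.sin_pos_of_pos_of_lt_pi (by nlinarith [hy.1]) (by nlinarith [hy.2])
  have h1 : 2 * Real.pi * y = Real.pi * (x + y) + Real.pi * (y - x) := by ring
  have h2 : 2 * Real.pi * x = Real.pi * (x + y) - Real.pi * (y - x) := by ring
  have hs1 := Real.sin_sq_add_cos_sq (Real.pi * (x + y))
  have hs2 := Real.sin_sq_add_cos_sq (Real.pi * (y - x))
  have hn : p.re ^ 2 + p.im ^ 2 < 1 := by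
    have := Complex.sq_norm p
    rw [normSq_apply] at this
    nlinarith [norm_nonneg p]
  unfold side at h
  set S := Real.sin (Real.pi * (y - x))
  set C := Real.cos (Real.pi * (y - x))
  set s := Real.sin (Real.pi * (x + y))
  set c := Real.cos (Real.pi * (x + y))
  -- `β` is the coordinate of `p` along the chord, measured from its midpoint, and `S` is the
  -- half-length of the chord; being in the disk means `β ^ 2 < S ^ 2`.
  set β := p.im * c - p.re * s with hβ
  have hb : β ^ 2 < S ^ 2 := by
    have : β ^ 2 + C ^ 2 = p.re ^ 2 + p.im ^ 2 := by
      rw [show C = p.re * c + p.im * s by linarith, hβ]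
      linear_combination (p.re ^ 2 + p.im ^ 2) * hs1
    linarith
  have hb' := abs_lt.1 (abs_lt_of_sq_lt_sq hb hs.le)
  have hre : p.re = C * c - β * s := by
    rw [show C = p.re * c + p.im * s by linarith, hβ]
    linear_combination -p.re * hs1
  have him : p.im = C * s + β * c := by
    rw [show C = p.re * c + p.im * s by linarith, hβ]
    linear_combination -p.im * hs1
  refine ⟨(S - β) / (2 * S), (S + β) / (2 * S), ?_, ?_, ?_, ?_⟩
  · apply div_nonneg <;> linarith [hb'.2]
  · apply div_nonneg <;> linarith [hb'.1]
  · field_simp; ring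
  · apply Complex.ext
    · simp only [add_re, smul_re, smul_eq_mul, unitPoint_re, h1, h2, Real.cos_add, Real.cos_sub]
      rw [hre]
      change (S - β) / (2 * S) * (c * C + s * S) + (S + β) / (2 * S) * (c * C - s * S) = _
      field_simp
      ring
    · simp only [add_im, smul_im, smul_eq_mul, unitPoint_im, h1, h2, Real.sin_add, Real.sin_sub]
      rw [him]
      change (S - β) / (2 * S) * (s * C - c * S) + (S + β) / (2 * S) * (s * C + c * S) = _
      field_simp
      ring

theorem affineCombination_eq_sum (T : Affine.Triangle ℝ ℂ) {w : Fin 3 → ℝ} (hw : ∑ i, w i = 1) :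
    Finset.univ.affineCombination ℝ T.points w = ∑ i, w i • T.points i :=
  Finset.affineCombination_eq_linear_combination _ _ _ hw

theorem cross_ne_zero (T : Affine.Triangle ℝ ℂ) {i j k : Fin 3} (hij : i ≠ j) (hik : i ≠ k)
    (hjk : j ≠ k) : cross (T.points j - T.points i) (T.points k - T.points i) ≠ 0 := by
  intro h
  have hind := T.independent
  rw [affineIndependent_iff_linearIndependent_vsub ℝ _ i] at hind
  have hpair : LinearIndependent ℝ ![T.points j - T.points i, T.points k - T.points i] := by
    have := hind.comp ![(⟨j, hij.symm⟩ : {x // x ≠ i}), ⟨k, hik.symm⟩] (by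
      intro a b hab
      fin_cases a <;> fin_cases b <;> simp_all)
    have e : ((fun l : {x // x ≠ i} => T.points l -ᵥ T.points i) ∘
        ![(⟨j, hij.symm⟩ : {x // x ≠ i}), ⟨k, hik.symm⟩]) =
        ![T.points j - T.points i, T.points k - T.points i] := by
      ext a
      fin_cases a <;> simp
    rwa [e] at this
  rw [LinearIndependent.pair_iff] at hpair
  set z := T.points j - T.points i
  set v := T.points k - T.points i
  unfold cross at h
  -- These combinations of `z` and `v` have one coordinate trivially zero and the other equal to the
  -- cross product up to sign.
  have h1 := hpair v.re (-z.re) (by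
    apply Complex.ext <;> simp
    · ring
    · linarith)
  have h2 := hpair v.im (-z.im) (by
    apply Complex.ext <;> simp
    · linarith
    · ring)
  have hz : z = 0 := Complex.ext (by simpa using h1.2) (by simpa using h2.2)
  have := hpair 1 0 (by simp [hz])
  simp at this

variable {T : Affine.Triangle ℝ ℂ}

theorem InDisk.norm_lt (hT : InDisk T) (i : Fin 3) : ‖T.points i‖ < 1 := by
  have := hT (T.point_mem_closedInterior i)
  simpa [disk] using this

theorem exists_side_ne_zero (T : Affine.Triangle ℝ ℂ) (x y : ℝ) :
    ∃ i, side (T.points i) x y ≠ 0 := by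
  by_contra! h
  have hcr := cross_ne_zero T (i := 0) (j := 1) (k := 2) (by decide) (by decide) (by decide)
  have h0 := h 0
  have h1 := h 1
  have h2 := h 2
  have hs := Real.sin_sq_add_cos_sq (Real.pi * (x + y))
  unfold side at h0 h1 h2
  set s := Real.sin (Real.pi * (x + y))
  set c := Real.cos (Real.pi * (x + y))
  set z := T.points 1 - T.points 0 with hz
  set v := T.points 2 - T.points 0 with hv
  have hz' : z.re * c + z.im * s = 0 := by rw [hz, sub_re, sub_im]; linarith
  have hv' : v.re * c + v.im * s = 0 := by rw [hv, sub_re, sub_im]; linarith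
  apply hcr
  unfold cross
  linear_combination (-(z.re * v.im - z.im * v.re)) * hs + (c * v.im - s * v.re) * hz' -
    (c * z.im - s * z.re) * hv'

/-! ### The bar billiard map and its lift -/

/-- The lift of the bar billiard map: the chord through the first vertex of `T` that is met. -/
noncomputable def psiLift (T : Affine.Triangle ℝ ℂ) (x : ℝ) : ℝ :=
  Finset.univ.inf' Finset.univ_nonempty fun i => chordMap (T.points i) x

theorem psiLift_le (T : Affine.Triangle ℝ ℂ) (x : ℝ) (i : Fin 3) :
    psiLift T x ≤ chordMap (T.points i) x :=
  Finset.inf'_le (fun i => chordMap (T.points i) x) (Finset.mem_univ i)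

theorem exists_psiLift_eq (T : Affine.Triangle ℝ ℂ) (x : ℝ) :
    ∃ i, psiLift T x = chordMap (T.points i) x := by
  obtain ⟨i, -, hi⟩ := Finset.exists_mem_eq_inf' Finset.univ_nonempty
    fun i => chordMap (T.points i) x
  exact ⟨i, hi⟩

theorem psiLift_mem_Ioo (hT : InDisk T) (x : ℝ) : psiLift T x ∈ Set.Ioo x (x + 1) := by
  obtain ⟨i, hi⟩ := exists_psiLift_eq T x
  rw [hi]
  exact chordMap_mem_Ioo (hT.norm_lt i) x

theorem psiLift_le_of_side_nonpos (hT : InDisk T) {x y : ℝ} (hy : y ∈ Set.Ioo x (x + 1))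
    (i : Fin 3) (h : side (T.points i) x y ≤ 0) : psiLift T x ≤ y :=
  (psiLift_le T x i).trans
    (le_of_not_gt fun hlt => h.not_gt ((side_pos_iff (hT.norm_lt i) hy).2 hlt))

theorem le_psiLift_iff (hT : InDisk T) {x y : ℝ} (hy : y ∈ Set.Ioo x (x + 1)) :
    y ≤ psiLift T x ↔ ∀ i, 0 ≤ side (T.points i) x y := by
  simp only [psiLift, Finset.le_inf'_iff, Finset.mem_univ, true_implies]
  exact forall_congr' fun i => (side_nonneg_iff (hT.norm_lt i) hy).symm

/-- At `psiLift` the vertices are weakly left of the chord and, not being collinear, not all on it,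
so positive weights put the interior strictly left. For a shorter arc all vertices are strictly
left, and the chord misses the triangle. -/
theorem isLeast_tangentArcs (hT : InDisk T) (x : ℝ) :
    IsLeast (tangentArcs T x) (psiLift T x - x) := by
  have hmem := psiLift_mem_Ioo hT x
  constructor
  · refine ⟨⟨by linarith [hmem.1], by linarith [hmem.2]⟩, ?_⟩
    rw [← AddCircle.coe_add, add_sub_cancel]
    constructor
    · obtain ⟨i, hi⟩ := exists_psiLift_eq T x
      refine ⟨T.points i, mem_segment_of_side_eq_zero (hT.norm_lt i) hmem ?_,
        T.point_mem_closedInterior i⟩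
      rw [hi, side_chordMap]
    · rw [Set.disjoint_left]
      rintro z hz ⟨w, hw, hw01, rfl⟩
      rw [affineCombination_eq_sum T hw] at hz
      have h0 := side_eq_zero_of_mem_segment hz
      rw [side_affine_combination _ hw] at h0
      obtain ⟨i, hi⟩ := exists_side_ne_zero T x (psiLift T x)
      have hnn := (le_psiLift_iff hT hmem).1 le_rfl
      have := (Finset.sum_eq_zero_iff_of_nonneg
        fun j _ => mul_nonneg (hw01 j).1.le (hnn j)).1 h0 i (Finset.mem_univ i)
      exact (mul_ne_zero (hw01 i).1.ne' hi) this
  · rintro t ⟨ht, ⟨z, hz, w, hw, hw01, rfl⟩, -⟩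
    rw [← AddCircle.coe_add] at hz
    rw [affineCombination_eq_sum T hw] at hz
    have h0 := side_eq_zero_of_mem_segment hz
    rw [side_affine_combination _ hw] at h0
    by_contra! hlt
    have hy : x + t ∈ Set.Ioo x (x + 1) := ⟨by linarith [ht.1], by linarith [ht.2]⟩
    have hpos : ∀ i, 0 < side (T.points i) x (x + t) := fun i =>
      (side_pos_iff (hT.norm_lt i) hy).2 (by linarith [psiLift_le T x i])
    have hz0 := (Finset.sum_eq_zero_iff_of_nonneg
      fun j _ => mul_nonneg (hw01 j).1 (hpos j).le).1 h0
    have hw0 : ∀ i, w i = 0 := fun i =>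
      (mul_eq_zero.1 (hz0 i (Finset.mem_univ i))).resolve_right (hpos i).ne'
    simp [hw0] at hw

theorem psi_coe (hT : InDisk T) (x : ℝ) : psi T x = (psiLift T x : ℝ) := by
  rw [psi, (isLeast_tangentArcs hT x).csInf_eq, ← AddCircle.coe_add, add_sub_cancel]

/-- The normalized lift of the bar billiard map, as a monotone map of degree one. -/
noncomputable def psiDeg1Lift (hT : InDisk T) : CircleDeg1Lift where
  toFun := psiLift T
  monotone' x y hxy := by
    refine Finset.le_inf' _ _ fun i _ => (psiLift_le T x i).trans ?_
    exact (strictMono_chordMap (hT.norm_lt i)).monotone hxy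
  map_add_one' x := by
    apply le_antisymm
    · obtain ⟨i, hi⟩ := exists_psiLift_eq T x
      rw [hi, ← chordMap_add_one]
      exact psiLift_le T _ i
    · obtain ⟨i, hi⟩ := exists_psiLift_eq T (x + 1)
      rw [hi, chordMap_add_one]
      exact add_le_add_left (psiLift_le T _ i) 1

theorem isNormalizedLift_psiDeg1Lift (hT : InDisk T) :
    IsNormalizedLift (psi T) (psiDeg1Lift hT) := by
  refine ⟨?_, fun x => (psi_coe hT x).symm, ?_⟩
  · exact Continuous.finset_inf'_apply Finset.univ_nonempty
      fun i _ => continuous_chordMap (hT.norm_lt i)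
  · have := psiLift_mem_Ioo hT 0
    rwa [zero_add] at this

theorem rotationNumber_psi (hT : InDisk T) :
    rotationNumber (psi T) = (psiDeg1Lift hT).translationNumber := by
  have h : ∃ F, IsNormalizedLift (psi T) F := ⟨_, isNormalizedLift_psiDeg1Lift hT⟩
  rw [rotationNumber, dif_pos h, h.choose_spec.unique (isNormalizedLift_psiDeg1Lift hT)]

/-! ### Rotation number bounds from inscribed triangles -/

theorem sin_pi_mul_pos {x y : ℝ} (hy : y ∈ Set.Ioo x (x + 1)) :
    0 < Real.sin (Real.pi * (y - x)) := by
  have hpi := Real.pi_pos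
  exact Real.sin_pos_of_pos_of_lt_pi (by nlinarith [hy.1]) (by nlinarith [hy.2])

theorem cross_unitPoint_nonneg_iff {x y : ℝ} (hy : y ∈ Set.Ioo x (x + 1)) (p : ℂ) :
    0 ≤ cross (unitPoint y - unitPoint x) (p - unitPoint x) ↔ 0 ≤ side p x y := by
  rw [cross_unitPoint]
  exact mul_nonneg_iff_of_pos_left (mul_pos two_pos (sin_pi_mul_pos hy))

theorem cross_unitPoint_pos_iff {x y : ℝ} (hy : y ∈ Set.Ioo x (x + 1)) (p : ℂ) :
    0 < cross (unitPoint y - unitPoint x) (p - unitPoint x) ↔ 0 < side p x y := by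
  rw [cross_unitPoint]
  exact mul_pos_iff_of_pos_left (mul_pos two_pos (sin_pi_mul_pos hy))

theorem exists_unitPoint_eq {z : ℂ} (hz : ‖z‖ = 1) (a : ℝ) :
    ∃ x ∈ Set.Ico a (a + 1), unitPoint x = z := by
  have hz0 : unitPoint (arg z / (2 * Real.pi)) = z := by
    rw [unitPoint_eq_exp, show 2 * Real.pi * (arg z / (2 * Real.pi)) = arg z by
      field_simp [Real.pi_ne_zero]]
    have := norm_mul_exp_arg_mul_I z
    rwa [hz, ofReal_one, one_mul] at this
  obtain ⟨x, hx, hxz⟩ := AddCircle.coe_image_Ico_eq (1 : ℝ) a ▸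
    Set.mem_univ ((arg z / (2 * Real.pi) : ℝ) : UnitAddCircle)
  refine ⟨x, hx, ?_⟩
  rw [← hz0, unitPoint, unitPoint, hxz]

/-- The vertices of a counterclockwise triangle inscribed in the unit circle have increasing lifts
within one turn. -/
theorem exists_lifts {X Y Z : ℂ} (hX : ‖X‖ = 1) (hY : ‖Y‖ = 1) (hZ : ‖Z‖ = 1)
    (h : 0 < cross (Y - X) (Z - X)) :
    ∃ x y z : ℝ, unitPoint x = X ∧ unitPoint y = Y ∧ unitPoint z = Z ∧
      x < y ∧ y < z ∧ z < x + 1 := by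
  obtain ⟨x, -, rfl⟩ := exists_unitPoint_eq hX 0
  obtain ⟨y, hy, rfl⟩ := exists_unitPoint_eq hY x
  obtain ⟨z, hz, rfl⟩ := exists_unitPoint_eq hZ x
  have hxy : x < y := lt_of_le_of_ne hy.1 fun e => by simp [e, cross] at h
  have hxz : x < z := lt_of_le_of_ne hz.1 fun e => by simp [e, cross] at h
  refine ⟨x, y, z, rfl, rfl, rfl, hxy, ?_, hz.2⟩
  rw [cross_unitPoint_pos_iff ⟨hxy, hy.2⟩, side_unitPoint] at h
  have hpos := (pos_iff_pos_of_mul_pos h).1 (mul_pos two_pos (sin_pi_mul_pos ⟨hxz, hz.2⟩))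
  by_contra! hle
  have hpi := Real.pi_pos
  refine hpos.not_ge (Real.sin_nonpos_of_nonpos_of_neg_pi_le ?_ ?_)
  · nlinarith
  · nlinarith [hy.2]

/-- If each side of a counterclockwise inscribed triangle has a vertex of `T` weakly on its right,
then the rotation number is at most `1 / 3`. -/
theorem rotationNumber_le_third (hT : InDisk T) {X Y Z : ℂ} (hX : ‖X‖ = 1) (hY : ‖Y‖ = 1)
    (hZ : ‖Z‖ = 1) (h : 0 < cross (Y - X) (Z - X)) (i j k : Fin 3)
    (hi : cross (Y - X) (T.points i - X) ≤ 0) (hj : cross (Z - Y) (T.points j - Y) ≤ 0)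
    (hk : cross (X - Z) (T.points k - Z) ≤ 0) : rotationNumber (psi T) ≤ 1 / 3 := by
  obtain ⟨x, y, z, rfl, rfl, rfl, hxy, hyz, hzx⟩ := exists_lifts hX hY hZ h
  have hyx : y ∈ Set.Ioo x (x + 1) := ⟨hxy, by linarith⟩
  have hzy : z ∈ Set.Ioo y (y + 1) := ⟨hyz, by linarith⟩
  have hxz : x + 1 ∈ Set.Ioo z (z + 1) := ⟨hzx, by linarith⟩
  rw [← unitPoint_add_one x] at hk
  rw [← not_lt, cross_unitPoint_pos_iff hyx, not_lt] at hi
  rw [← not_lt, cross_unitPoint_pos_iff hzy, not_lt] at hj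
  rw [← not_lt, cross_unitPoint_pos_iff hxz, not_lt] at hk
  set F := psiDeg1Lift hT
  have h1 : F x ≤ y := psiLift_le_of_side_nonpos hT hyx i hi
  have h2 : F y ≤ z := psiLift_le_of_side_nonpos hT hzy j hj
  have h3 : F z ≤ x + 1 := psiLift_le_of_side_nonpos hT hxz k hk
  have h4 : (F ^ 3) x ≤ x + (1 : ℕ) := by
    simpa [pow_succ] using (F.mono ((F.mono h1).trans h2)).trans h3
  have h5 := CircleDeg1Lift.translationNumber_le_of_le_add_nat _ h4
  rw [CircleDeg1Lift.translationNumber_pow] at h5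
  rw [rotationNumber_psi hT]
  push_cast at h5
  linarith

/-- If `T` lies in a counterclockwise inscribed triangle, then the rotation number is at least
`1 / 3`. -/
theorem third_le_rotationNumber (hT : InDisk T) {X Y Z : ℂ} (hX : ‖X‖ = 1) (hY : ‖Y‖ = 1)
    (hZ : ‖Z‖ = 1) (h : 0 < cross (Y - X) (Z - X))
    (h1 : ∀ i, 0 ≤ cross (Y - X) (T.points i - X)) (h2 : ∀ i, 0 ≤ cross (Z - Y) (T.points i - Y))
    (h3 : ∀ i, 0 ≤ cross (X - Z) (T.points i - Z)) : 1 / 3 ≤ rotationNumber (psi T) := by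
  obtain ⟨x, y, z, rfl, rfl, rfl, hxy, hyz, hzx⟩ := exists_lifts hX hY hZ h
  have hyx : y ∈ Set.Ioo x (x + 1) := ⟨hxy, by linarith⟩
  have hzy : z ∈ Set.Ioo y (y + 1) := ⟨hyz, by linarith⟩
  have hxz : x + 1 ∈ Set.Ioo z (z + 1) := ⟨hzx, by linarith⟩
  rw [← unitPoint_add_one x] at h3
  set F := psiDeg1Lift hT
  have e1 : y ≤ F x := (le_psiLift_iff hT hyx).2
    fun i => (cross_unitPoint_nonneg_iff hyx _).1 (h1 i)
  have e2 : z ≤ F y := (le_psiLift_iff hT hzy).2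
    fun i => (cross_unitPoint_nonneg_iff hzy _).1 (h2 i)
  have e3 : x + 1 ≤ F z := (le_psiLift_iff hT hxz).2
    fun i => (cross_unitPoint_nonneg_iff hxz _).1 (h3 i)
  have h4 : x + (1 : ℕ) ≤ (F ^ 3) x := by
    simpa [pow_succ] using e3.trans (F.mono (e2.trans (F.mono e1)))
  have h5 := CircleDeg1Lift.le_translationNumber_of_add_nat_le _ h4
  rw [CircleDeg1Lift.translationNumber_pow] at h5
  rw [rotationNumber_psi hT]
  push_cast at h5
  linarith

/-! ### The lower bound, in a frame along the longest side -/

theorem cross_mul_left {u : ℂ} (hu : ‖u‖ = 1) (z w v : ℂ) :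
    cross (u * z - u * v) (u * w - u * v) = cross (z - v) (w - v) := by
  have h := Complex.sq_norm u
  rw [hu, normSq_apply] at h
  simp only [cross, sub_re, sub_im, mul_re, mul_im]
  linear_combination
    (-((z.re - v.re) * (w.im - v.im) - (z.im - v.im) * (w.re - v.re))) * h

theorem sq_norm_eq (z : ℂ) : ‖z‖ ^ 2 = z.re ^ 2 + z.im ^ 2 := by
  rw [Complex.sq_norm, normSq_apply]; ring

theorem sq_add_sq_lt_one {z : ℂ} (h : ‖z‖ < 1) : z.re ^ 2 + z.im ^ 2 < 1 := by
  rw [← sq_norm_eq]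
  nlinarith [norm_nonneg z]

theorem norm_eq_one_of_sq {z : ℂ} (h : z.re ^ 2 + z.im ^ 2 = 1) : ‖z‖ = 1 := by
  rw [← sq_norm_eq] at h
  exact (pow_eq_one_iff_of_nonneg (norm_nonneg z) two_ne_zero).1 h

/-- If the third vertex projects into the opposite side, then the rotation number is at least
`1 / 3`. The coordinates `p`, `q`, `r` are those in a frame with first axis along that side. -/
theorem third_le_of_foot_mem {T : Affine.Triangle ℝ ℂ} (hT : InDisk T) {i j k : Fin 3}
    (hijk : ∀ l, l = i ∨ l = j ∨ l = k) {u p q r : ℂ} (hu : ‖u‖ = 1) (hi : T.points i = u * p)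
    (hj : T.points j = u * q) (hk : T.points k = u * r) (him : p.im = q.im) (hr : p.im < r.im)
    (hpr : p.re ≤ r.re) (hrq : r.re ≤ q.re) : 1 / 3 ≤ rotationNumber (psi T) := by
  have np : ‖p‖ < 1 := by simpa [hi, hu] using hT.norm_lt i
  have nq : ‖q‖ < 1 := by simpa [hj, hu] using hT.norm_lt j
  have nr : ‖r‖ < 1 := by simpa [hk, hu] using hT.norm_lt k
  replace np := sq_add_sq_lt_one np
  replace nq := sq_add_sq_lt_one nq
  replace nr := sq_add_sq_lt_one nr
  set h := p.im with hh
  -- `c` is the half-length of the chord on the line of `p` and `q`; `d` is the height at which the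
  -- vertical through `r` leaves the disk.
  set c := √(1 - h ^ 2) with hc
  set d := √(1 - r.re ^ 2) with hd
  have hc2 : c ^ 2 = 1 - h ^ 2 := Real.sq_sqrt (by nlinarith [sq_nonneg p.re])
  have hd2 : d ^ 2 = 1 - r.re ^ 2 := Real.sq_sqrt (by nlinarith [sq_nonneg r.im])
  have hc0 : 0 ≤ c := Real.sqrt_nonneg _
  have hd0 : 0 ≤ d := Real.sqrt_nonneg _
  have hp' := abs_lt.1 (abs_lt_of_sq_lt_sq (show p.re ^ 2 < c ^ 2 by linarith) hc0)
  have hq' := abs_lt.1 (abs_lt_of_sq_lt_sq (show q.re ^ 2 < c ^ 2 by rw [hc2, him]; linarith) hc0)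
  have hr' := abs_lt.1 (abs_lt_of_sq_lt_sq (show r.im ^ 2 < d ^ 2 by linarith) hd0)
  have hX : ‖(⟨-c, h⟩ : ℂ)‖ = 1 := norm_eq_one_of_sq (by simp; linarith)
  have hY : ‖(⟨c, h⟩ : ℂ)‖ = 1 := norm_eq_one_of_sq (by simp; linarith)
  have hZ : ‖(⟨r.re, d⟩ : ℂ)‖ = 1 := norm_eq_one_of_sq (by simp; linarith)
  have hdh : 0 ≤ d - h := by linarith
  -- The three inequalities say that `v` is weakly left of `XY`, `YZ` and `ZX`.
  have key : ∀ l, ∃ v : ℂ, T.points l = u * v ∧ h ≤ v.im ∧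
      (d - h) * (v.re - c) ≤ (v.im - h) * (r.re - c) ∧
      (v.im - h) * (r.re + c) ≤ (d - h) * (v.re + c) := by
    intro l
    rcases hijk l with rfl | rfl | rfl
    · refine ⟨p, hi, le_rfl, ?_, ?_⟩
      · rw [← hh, sub_self, zero_mul]
        exact mul_nonpos_of_nonneg_of_nonpos hdh (by linarith)
      · rw [← hh, sub_self, zero_mul]
        exact mul_nonneg hdh (by linarith)
    · refine ⟨q, hj, him.le, ?_, ?_⟩
      · rw [← him, sub_self, zero_mul]
        exact mul_nonpos_of_nonneg_of_nonpos hdh (by linarith)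
      · rw [← him, sub_self, zero_mul]
        exact mul_nonneg hdh (by linarith)
    · refine ⟨r, hk, hr.le, ?_, ?_⟩
      · exact mul_le_mul_of_nonpos_right (by linarith) (by linarith)
      · exact mul_le_mul_of_nonneg_right (by linarith) (by linarith)
  refine third_le_rotationNumber hT (X := u * ⟨-c, h⟩) (Y := u * ⟨c, h⟩) (Z := u * ⟨r.re, d⟩)
    (by rw [norm_mul, hu, hX, one_mul]) (by rw [norm_mul, hu, hY, one_mul])
    (by rw [norm_mul, hu, hZ, one_mul]) ?_ ?_ ?_ ?_
  · rw [cross_mul_left hu]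
    simp only [cross, sub_re, sub_im]
    have : 0 < c * (d - h) := mul_pos (by linarith) (by linarith)
    linarith
  all_goals
    intro l
    obtain ⟨v, hv, h1, h2, h3⟩ := key l
    have h4 := mul_nonneg hc0 (sub_nonneg.2 h1)
    rw [hv, cross_mul_left hu]
    simp only [cross, sub_re, sub_im]
    linarith

/-! ### The upper bound for large triangles -/

/-- A triangle of the unit disk whose smallest enclosing circle has centre `o` and radius `ρ`
satisfies `‖o‖² + ρ² < 1`. -/
theorem sq_norm_center_lt {a s x y ρ : ℝ} {o : ℂ} (hρ : 0 < ρ) (ha : 0 < a) (hs : 0 ≤ s)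
    (has : a ^ 2 + s ^ 2 = 1) (hy : 0 < y) (hx : |x| ≤ a) (hxy : 0 < s → x ^ 2 + (y - s) ^ 2 = 1)
    (hp : ‖o + ρ * (-a - s * I)‖ < 1) (hq : ‖o + ρ * (a - s * I)‖ < 1)
    (hr : ‖o + ρ * (x + (y - s) * I)‖ < 1) : ‖o‖ ^ 2 + ρ ^ 2 < 1 := by
  rw [sq_norm_eq]
  replace hp := sq_add_sq_lt_one hp
  replace hq := sq_add_sq_lt_one hq
  replace hr := sq_add_sq_lt_one hr
  simp at hp hq hr
  -- Otherwise any vertex `o + ρ v` with `‖v‖ = 1` has `v` at an obtuse angle to `o`. For the two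
  -- base vertices this forces `s` and `o.im` to be positive; then the third vertex is also on the
  -- circle, at height at least `s`, and cannot satisfy the same condition.
  by_contra! hN
  have h1 : 0 < o.re * a + o.im * s := by
    have : 0 < ρ * (o.re * a + o.im * s) := by nlinarith
    exact pos_of_mul_pos_right this hρ.le
  have h2 : 0 < -(o.re * a) + o.im * s := by
    have : 0 < ρ * (-(o.re * a) + o.im * s) := by nlinarith
    exact pos_of_mul_pos_right this hρ.le
  have h3 : |o.re| * a < o.im * s := by
    rw [← abs_of_pos ha, ← abs_mul, abs_lt]
    constructor <;> linarith
  have h4 : 0 < o.im * s := lt_of_le_of_lt (by positivity) h3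
  have hs' : 0 < s := lt_of_le_of_ne hs fun e => by simp [← e] at h4
  have ho : 0 < o.im := pos_of_mul_pos_left h4 hs
  have hR := hxy hs'
  have h5 : s ≤ y - s := by
    have : s ^ 2 ≤ (y - s) ^ 2 := by nlinarith [sq_abs x, abs_nonneg x]
    by_contra! hlt
    nlinarith
  have h6 : o.re * x + o.im * (y - s) < 0 := by
    have : 0 < ρ * -(o.re * x + o.im * (y - s)) := by nlinarith
    have := pos_of_mul_pos_right this hρ.le
    linarith
  have h7 : -(|o.re| * a) ≤ o.re * x := by
    have : |o.re * x| ≤ |o.re| * a := by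
      rw [abs_mul]; gcongr
    linarith [neg_abs_le (o.re * x)]
  nlinarith

/-- With `t = y / 2 - s`, the corner `(a, -s)` is strictly right of the line from `(0, -1)` to `(√(1
- t ^ 2), t)`. After squaring and cancelling `(1 - s) * (1 + t)` this reads `(1 - s) * (1 - t) < (1
+ s) * (1 + t)`, that is `0 < y`. -/
theorem chord_margin_pos {a s y : ℝ} (ha : 0 < a) (hs : 0 ≤ s) (has : a ^ 2 + s ^ 2 = 1)
    (hy : 0 < y) (hys : y - s ≤ 1) :
    √(1 - (y / 2 - s) ^ 2) * (1 - s) < a * (1 + (y / 2 - s)) := by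
  have hs1 : s < 1 := by nlinarith
  have ht1 : 0 < 1 + (y / 2 - s) := by linarith
  have ht2 : 0 < 1 - (y / 2 - s) := by linarith
  have hb : √(1 - (y / 2 - s) ^ 2) ^ 2 = 1 - (y / 2 - s) ^ 2 := Real.sq_sqrt (by nlinarith)
  refine lt_of_pow_lt_pow_left₀ 2 (by positivity) ?_
  rw [mul_pow, mul_pow, hb, show a ^ 2 = (1 - s) * (1 + s) by linarith]
  have : 0 < (1 - s) * (1 + (y / 2 - s)) * y := by
    have : 0 < 1 - s := by linarith
    positivity
  nlinarith

/-- A triangle whose smallest enclosing circle is close to the unit circle has rotation number at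
most `1 / 3`. -/
theorem le_third_of_near {T : Affine.Triangle ℝ ℂ} (hT : InDisk T) {i j k : Fin 3}
    {u o r : ℂ} {a s y ρ d : ℝ} (hu : ‖u‖ = 1)
    (hi : T.points i = u * (o + ρ * (-a - s * I))) (hj : T.points j = u * (o + ρ * (a - s * I)))
    (hk : T.points k = u * r) (hr : r.im = o.im + ρ * (y - s)) (ha : 0 < a) (hs : 0 ≤ s)
    (has : a ^ 2 + s ^ 2 = 1) (hy : 0 < y) (hys : y - s ≤ 1) (hρ1 : ρ ≤ 1)
    (hd : ‖o‖ + (1 - ρ) ≤ d)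
    (hd1 : 3 * d ≤ a * (1 + (y / 2 - s)) - √(1 - (y / 2 - s) ^ 2) * (1 - s)) (hd2 : d ≤ y / 2) :
    rotationNumber (psi T) ≤ 1 / 3 := by
  have hs1 : s < 1 := by nlinarith
  have ha1 : a ≤ 1 := by nlinarith
  have ht1 : 0 < 1 + (y / 2 - s) := by linarith
  have ht2 : 0 < 1 - (y / 2 - s) := by linarith
  have hb : √(1 - (y / 2 - s) ^ 2) ^ 2 = 1 - (y / 2 - s) ^ 2 := Real.sq_sqrt (by nlinarith)
  have hb0 : 0 < √(1 - (y / 2 - s) ^ 2) := Real.sqrt_pos.2 (by nlinarith)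
  set t := y / 2 - s with ht
  set b := √(1 - t ^ 2)
  have hb1 : b ≤ 1 := by nlinarith
  have hre := abs_le.1 (abs_re_le_norm o)
  have him := abs_le.1 (abs_im_le_norm o)
  set e := ‖o‖
  have he : 0 ≤ e := norm_nonneg o
  have hX : ‖(⟨0, -1⟩ : ℂ)‖ = 1 := norm_eq_one_of_sq (by simp)
  have hY : ‖(⟨b, t⟩ : ℂ)‖ = 1 := norm_eq_one_of_sq (by simp; linarith)
  have hZ : ‖(⟨-b, t⟩ : ℂ)‖ = 1 := norm_eq_one_of_sq (by simp; linarith)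
  -- Displacing the centre by `o` and shrinking by `1 - ρ` costs the base corners at most `3 * (‖o‖
  -- + (1 - ρ))` of their margin.
  have f1 : b * (o.im + (1 - ρ) * s) ≤ e + (1 - ρ) := by
    have h1 : b * o.im ≤ 1 * e :=
      (mul_le_mul_of_nonneg_left him.2 hb0.le).trans (mul_le_mul_of_nonneg_right hb1 he)
    have h2 : b * s ≤ 1 := mul_le_one₀ hb1 hs hs1.le
    have h3 : (1 - ρ) * (b * s) ≤ (1 - ρ) * 1 := mul_le_mul_of_nonneg_left h2 (by linarith)
    linarith
  have f2 : (1 + t) * ((1 - ρ) * a + e) ≤ 2 * (e + (1 - ρ)) := by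
    have h0 : (1 - ρ) * a ≤ (1 - ρ) * 1 := mul_le_mul_of_nonneg_left ha1 (by linarith)
    have h1 : (1 - ρ) * a + e ≤ e + (1 - ρ) := by linarith
    have h2 : 0 ≤ (1 - ρ) * a := mul_nonneg (by linarith) ha.le
    exact mul_le_mul (by linarith) h1 (by linarith) zero_le_two
  have f3 : (1 + t) * -e ≤ (1 + t) * o.re := by gcongr; exact hre.1
  have f4 : (1 + t) * o.re ≤ (1 + t) * e := by gcongr; exact hre.2
  -- The test triangle has its apex at the bottom and its top side at height `t`, halfway between
  -- the base and the third vertex of the limiting triangle. The base corners `j`, `i` serve the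
  -- slanted sides and `k` the top.
  refine rotationNumber_le_third hT (X := u * ⟨0, -1⟩) (Y := u * ⟨b, t⟩) (Z := u * ⟨-b, t⟩)
    (by rw [norm_mul, hu, hX, one_mul]) (by rw [norm_mul, hu, hY, one_mul])
    (by rw [norm_mul, hu, hZ, one_mul]) ?_ j k i ?_ ?_ ?_
  · rw [cross_mul_left hu]
    simp only [cross, sub_re, sub_im]
    have : 0 < b * (1 + t) := mul_pos hb0 ht1
    linarith
  · rw [hj, cross_mul_left hu]
    simp [cross]
    linarith
  · rw [hk, cross_mul_left hu]
    simp only [cross, sub_re, sub_im, hr]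
    have : t ≤ o.im + ρ * (y - s) := by
      have : (1 - ρ) * (y - s) ≤ (1 - ρ) * 1 := mul_le_mul_of_nonneg_left hys (by linarith)
      linarith
    have := mul_le_mul_of_nonneg_left this hb0.le
    linarith
  · rw [hi, cross_mul_left hu]
    simp [cross]
    linarith

/-! ### Choice of the size -/

/-- For each shape of triangles there is a size at which every triangle of the disk has rotation
number `1 / 3`. -/
theorem exists_radius {a s x y : ℝ} (ha : 0 < a) (hs : 0 ≤ s) (has : a ^ 2 + s ^ 2 = 1)
    (hy : 0 < y) (hx : |x| ≤ a) (hxy : x ^ 2 + (y - s) ^ 2 ≤ 1)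
    (hxy' : 0 < s → x ^ 2 + (y - s) ^ 2 = 1) :
    ∃ ρ : ℝ, 0 < ρ ∧ ρ < 1 ∧ ∀ T : Affine.Triangle ℝ ℂ, InDisk T → ∀ i j k : Fin 3,
      (∀ l, l = i ∨ l = j ∨ l = k) → ∀ (u o : ℂ) (x' : ℝ), ‖u‖ = 1 → |x'| = |x| →
      T.points i = u * (o + ρ * (-a - s * I)) → T.points j = u * (o + ρ * (a - s * I)) →
      T.points k = u * (o + ρ * (x' + (y - s) * I)) → rotationNumber (psi T) = 1 / 3 := by
  have hys : y - s ≤ 1 := by nlinarith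
  have hm := chord_margin_pos ha hs has hy hys
  obtain ⟨d, hd0, hd⟩ := exists_between (a₁ := (0 : ℝ))
    (a₂ := min 1 (min ((a * (1 + (y / 2 - s)) - √(1 - (y / 2 - s) ^ 2) * (1 - s)) / 3) (y / 2)))
    (by
      refine lt_min one_pos (lt_min ?_ (by linarith))
      linarith)
  obtain ⟨hd1, hd2⟩ := lt_min_iff.1 hd
  obtain ⟨hd2, hd3⟩ := lt_min_iff.1 hd2
  -- Then `‖o‖ ^ 2 < 1 - ρ ^ 2` gives `‖o‖ < d / 2`, and `1 - ρ = d ^ 2 / 8` is at most `d / 2`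
  -- because `d < 1`.
  refine ⟨1 - d ^ 2 / 8, by nlinarith, by nlinarith, ?_⟩
  intro T hT i j k hijk u o x' hu hx' hi hj hk
  set ρ : ℝ := 1 - d ^ 2 / 8 with hρ
  have hρ0 : 0 < ρ := by nlinarith
  have np := hT.norm_lt i
  have nq := hT.norm_lt j
  have nr := hT.norm_lt k
  rw [hi, norm_mul, hu, one_mul] at np
  rw [hj, norm_mul, hu, one_mul] at nq
  rw [hk, norm_mul, hu, one_mul] at nr
  have hsq : x' ^ 2 = x ^ 2 := (sq_eq_sq_iff_abs_eq_abs _ _).2 hx'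
  have hx'a := abs_le.1 (hx'.le.trans hx)
  have ho := sq_norm_center_lt hρ0 ha hs has hy (hx'.le.trans hx)
    (fun h => by rw [hsq]; exact hxy' h) np nq nr
  apply le_antisymm
  · refine le_third_of_near hT hu hi hj hk (by simp) ha hs has hy hys (by nlinarith) ?_
      (show 3 * d ≤ _ by linarith) hd3.le
    have h1 : ‖o‖ < d / 2 := by
      refine lt_of_pow_lt_pow_left₀ 2 (by positivity) ?_
      rw [hρ] at ho
      nlinarith
    rw [hρ]
    nlinarith
  · refine third_le_of_foot_mem hT hijk hu hi hj hk (by simp) ?_ ?_ ?_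
    · have := mul_pos hρ0 hy
      simp
      linarith
    · have := mul_le_mul_of_nonneg_left hx'a.1 hρ0.le
      simp
      linarith
    · have := mul_le_mul_of_nonneg_left hx'a.2 hρ0.le
      simp
      linarith

/-! ### Normal forms and scaling of triangles -/

/-- Two points and a third one, given by their distances, in coordinates along the first two. -/
theorem exists_frame {p q r : ℂ} {A X Y : ℝ} (hA : 0 < A) (hpq : ‖q - p‖ = 2 * A)
    (hpr : ‖r - p‖ ^ 2 = (X + A) ^ 2 + Y ^ 2) (hqr : ‖r - q‖ ^ 2 = (X - A) ^ 2 + Y ^ 2) :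
    ∃ u m : ℂ, ‖u‖ = 1 ∧ p = u * (m - A) ∧ q = u * (m + A) ∧
      (r = u * (m + X + Y * I) ∨ r = u * (m + X - Y * I)) := by
  have hA' : (A : ℂ) ≠ 0 := by exact_mod_cast hA.ne'
  set u := (q - p) / (2 * A) with hu
  have hun : ‖u‖ = 1 := by
    rw [hu, norm_div, hpq, norm_mul, norm_real, Real.norm_of_nonneg hA.le, Complex.norm_ofNat]
    exact div_self (by positivity)
  have hu0 : u ≠ 0 := by
    intro h
    simp [h] at hun
  have huA : u * (2 * A) = q - p := by rw [hu]; field_simp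
  set m := (p + q) / (2 * u) with hm
  have hmu : u * m = (p + q) / 2 := by rw [hm]; field_simp
  have hp : p = u * (m - A) := by linear_combination -hmu + huA / 2
  have hq : q = u * (m + A) := by linear_combination -hmu - huA / 2
  set v := r / u - m with hv
  have hr : r = u * (m + v) := by rw [hv]; field_simp; ring
  have h1 : (v.re + A) ^ 2 + v.im ^ 2 = (X + A) ^ 2 + Y ^ 2 := by
    rw [← hpr, show r - p = u * (v + A) by rw [hr, hp]; ring, norm_mul, hun, one_mul, sq_norm_eq]
    simp
  have h2 : (v.re - A) ^ 2 + v.im ^ 2 = (X - A) ^ 2 + Y ^ 2 := by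
    rw [← hqr, show r - q = u * (v - A) by rw [hr, hq]; ring, norm_mul, hun, one_mul, sq_norm_eq]
    simp
  have h3 : v.re = X := mul_left_cancel₀ hA.ne' (by linarith)
  have h4 : v.im ^ 2 = Y ^ 2 := by rw [h3] at h1; linarith
  refine ⟨u, m, hun, hp, hq, (sq_eq_sq_iff_eq_or_eq_neg.1 h4).imp (fun h => ?_) fun h => ?_⟩
  · rw [hr, ← re_add_im v, h3, h]; ring
  · rw [hr, ← re_add_im v, h3, h]; push_cast; ring

/-- The shape of a triangle with longest side `pq`, normalized so that its smallest enclosing circle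
has radius `1`; the actual radius and centre of that circle are `ℓ` and `c`. -/
theorem exists_shape {p q r : ℂ} (h : cross (q - p) (r - p) ≠ 0) (hp : ‖r - p‖ ≤ ‖q - p‖)
    (hq : ‖r - q‖ ≤ ‖q - p‖) :
    ∃ (a s x y ℓ : ℝ) (c : ℂ), 0 < a ∧ 0 ≤ s ∧ a ^ 2 + s ^ 2 = 1 ∧ 0 < y ∧ |x| ≤ a ∧
      x ^ 2 + (y - s) ^ 2 ≤ 1 ∧ (0 < s → x ^ 2 + (y - s) ^ 2 = 1) ∧ 0 < ℓ ∧
      ‖q - p‖ = 2 * (ℓ * a) ∧ ‖r - p‖ ^ 2 = (ℓ * x + ℓ * a) ^ 2 + (ℓ * y) ^ 2 ∧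
      ‖r - q‖ ^ 2 = (ℓ * x - ℓ * a) ^ 2 + (ℓ * y) ^ 2 ∧
      ‖p - c‖ ≤ ℓ ∧ ‖q - c‖ ≤ ℓ ∧ ‖r - c‖ ≤ ℓ := by
  have hqp : q - p ≠ 0 := by
    intro h0
    simp [h0, cross] at h
  obtain ⟨L, hL⟩ : ∃ L, L = ‖q - p‖ / 2 := ⟨_, rfl⟩
  have hL0 : 0 < L := by rw [hL]; have := norm_pos_iff.2 hqp; positivity
  have hLc : (L : ℂ) ≠ 0 := by exact_mod_cast hL0.ne'
  obtain ⟨u, hu⟩ : ∃ u, u = (q - p) / (2 * L) := ⟨_, rfl⟩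
  have hun : ‖u‖ = 1 := by
    rw [hu, norm_div, norm_mul, norm_real, Real.norm_of_nonneg hL0.le, hL]
    have := norm_pos_iff.2 hqp
    simp
    field_simp
  have hu0 : u ≠ 0 := by
    intro h0
    simp [h0] at hun
  obtain ⟨m, hm⟩ : ∃ m, m = (p + q) / 2 := ⟨_, rfl⟩
  obtain ⟨v, hv⟩ : ∃ v, v = (r - m) / u := ⟨_, rfl⟩
  have huL : u * (2 * L) = q - p := by rw [hu]; field_simp
  have ep : p = m - u * L := by rw [hm]; linear_combination huL / 2
  have eq' : q = m + u * L := by rw [hm]; linear_combination -huL / 2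
  have er : r = m + u * v := by rw [hv]; field_simp; ring
  have h1 : ‖q - p‖ = 2 * L := by rw [hL]; ring
  have h2 : ‖r - p‖ ^ 2 = (v.re + L) ^ 2 + v.im ^ 2 := by
    rw [show r - p = u * (v + L) by rw [er, ep]; ring, norm_mul, hun, one_mul, sq_norm_eq]
    simp
  have h3 : ‖r - q‖ ^ 2 = (v.re - L) ^ 2 + v.im ^ 2 := by
    rw [show r - q = u * (v - L) by rw [er, eq']; ring, norm_mul, hun, one_mul, sq_norm_eq]
    simp
  have hv0 : v.im ≠ 0 := by
    intro h0
    apply h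
    have e1 : q - p = u * ((2 * L : ℝ) : ℂ) - u * 0 := by push_cast; rw [huL]; ring
    have e2 : r - p = u * (v + L) - u * 0 := by rw [er, ep]; ring
    rw [e1, e2, cross_mul_left hun]
    simp [cross, h0]
  -- The sign `σ` records the side of `pq` on which `r` lies.
  obtain ⟨σ, hσ, hσv⟩ : ∃ σ : ℝ, σ ^ 2 = 1 ∧ v.im = σ * |v.im| := by
    rcases lt_or_gt_of_ne hv0 with h0 | h0
    · exact ⟨-1, by norm_num, by rw [abs_of_neg h0]; ring⟩
    · exact ⟨1, by norm_num, by rw [abs_of_pos h0]; ring⟩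
  have hY0 : 0 < |v.im| := abs_pos.2 hv0
  have hY2 : v.im ^ 2 = |v.im| ^ 2 := (sq_abs _).symm
  obtain ⟨Y, hY⟩ : ∃ Y, Y = |v.im| := ⟨_, rfl⟩
  rw [← hY] at hσv hY0 hY2
  obtain ⟨X, hX⟩ : ∃ X, X = v.re := ⟨_, rfl⟩
  rw [← hX, hY2] at h2 h3
  have hp2 : ‖r - p‖ ^ 2 ≤ (2 * L) ^ 2 := by rw [← h1]; gcongr
  have hq2 : ‖r - q‖ ^ 2 ≤ (2 * L) ^ 2 := by rw [← h1]; gcongr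
  -- Since `pq` is the longest side, the foot of `r` falls on it.
  have hXL : |X| ≤ L := by
    rw [abs_le]
    constructor <;> nlinarith
  -- The quotient is the signed height of the circumcentre over `pq`, towards `r`. If it is not
  -- positive, the circle with diameter `pq` already encloses the triangle and `S = 0`.
  obtain ⟨S, hS⟩ : ∃ S, S = max 0 ((X ^ 2 + Y ^ 2 - L ^ 2) / (2 * Y)) := ⟨_, rfl⟩
  have hS0 : 0 ≤ S := hS ▸ le_max_left _ _
  have hS1 : X ^ 2 + (Y - S) ^ 2 ≤ L ^ 2 + S ^ 2 := by
    have : (X ^ 2 + Y ^ 2 - L ^ 2) / (2 * Y) ≤ S := hS ▸ le_max_right _ _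
    rw [div_le_iff₀ (by positivity)] at this
    linarith
  have hS2 : 0 < S → X ^ 2 + (Y - S) ^ 2 = L ^ 2 + S ^ 2 := by
    intro h0
    have : S = (X ^ 2 + Y ^ 2 - L ^ 2) / (2 * Y) := by
      rcases max_choice 0 ((X ^ 2 + Y ^ 2 - L ^ 2) / (2 * Y)) with e | e
      · rw [e] at hS; exact absurd hS h0.ne'
      · rw [e] at hS; exact hS
    rw [eq_div_iff (by positivity)] at this
    linarith
  obtain ⟨ℓ, hℓ⟩ : ∃ ℓ, ℓ = √(L ^ 2 + S ^ 2) := ⟨_, rfl⟩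
  have hℓ0 : 0 < ℓ := by rw [hℓ]; positivity
  have hℓ2 : ℓ ^ 2 = L ^ 2 + S ^ 2 := by rw [hℓ]; exact Real.sq_sqrt (by positivity)
  have hle : ∀ z : ℂ, ‖z‖ ^ 2 ≤ ℓ ^ 2 → ‖z‖ ≤ ℓ := fun z hz =>
    le_of_sq_le_sq hz hℓ0.le
  refine ⟨L / ℓ, S / ℓ, X / ℓ, Y / ℓ, ℓ, m + u * (σ * S * I), by positivity, by positivity, ?_,
    by positivity, ?_, ?_, ?_, hℓ0, ?_, ?_, ?_, hle _ ?_, hle _ ?_, hle _ ?_⟩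
  · field_simp; linarith
  · rw [abs_div, abs_of_pos hℓ0]; gcongr
  · rw [← sub_div, div_pow, div_pow, ← add_div, div_le_one (by positivity)]; linarith
  · intro h0
    have := hS2 (by simpa [hℓ0] using h0)
    rw [← sub_div, div_pow, div_pow, ← add_div, div_eq_one_iff_eq (by positivity)]; linarith
  · rw [h1]; field_simp
  · rw [h2]; field_simp
  · rw [h3]; field_simp
  · rw [show p - (m + u * (σ * S * I)) = u * (-L - σ * S * I) by rw [ep]; ring, norm_mul, hun,
      one_mul, sq_norm_eq]
    simp [mul_pow, hσ, hℓ2]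
  · rw [show q - (m + u * (σ * S * I)) = u * (L - σ * S * I) by rw [eq']; ring, norm_mul, hun,
      one_mul, sq_norm_eq]
    simp [mul_pow, hσ, hℓ2]
  · rw [show r - (m + u * (σ * S * I)) = u * (v - σ * S * I) by rw [er]; ring, norm_mul, hun,
      one_mul, sq_norm_eq]
    have e : (σ * Y - σ * S) ^ 2 = (Y - S) ^ 2 := by linear_combination (Y - S) ^ 2 * hσ
    simp [← hX, hσv, e, hℓ2, hS1]

theorem exists_longest_side (T : Affine.Triangle ℝ ℂ) :
    ∃ i j k : Fin 3, i ≠ j ∧ i ≠ k ∧ j ≠ k ∧ (∀ l, l = i ∨ l = j ∨ l = k) ∧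
      ‖T.points k - T.points i‖ ≤ ‖T.points j - T.points i‖ ∧
      ‖T.points k - T.points j‖ ≤ ‖T.points j - T.points i‖ := by
  have h10 := norm_sub_rev (T.points 1) (T.points 0)
  have h20 := norm_sub_rev (T.points 2) (T.points 0)
  have h21 := norm_sub_rev (T.points 2) (T.points 1)
  rcases le_total ‖T.points 1 - T.points 0‖ ‖T.points 2 - T.points 0‖ with h1 | h1
  · rcases le_total ‖T.points 2 - T.points 0‖ ‖T.points 2 - T.points 1‖ with h2 | h2
    · exact ⟨1, 2, 0, by decide, by decide, by decide, by decide, by linarith, by linarith⟩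
    · exact ⟨0, 2, 1, by decide, by decide, by decide, by decide, by linarith, by linarith⟩
  · rcases le_total ‖T.points 1 - T.points 0‖ ‖T.points 2 - T.points 1‖ with h2 | h2
    · exact ⟨1, 2, 0, by decide, by decide, by decide, by decide, by linarith, by linarith⟩
    · exact ⟨0, 1, 2, by decide, by decide, by decide, by decide, by linarith, by linarith⟩

theorem inDisk_of_norm_lt {T : Affine.Triangle ℝ ℂ} (h : ∀ i, ‖T.points i‖ < 1) : InDisk T := by
  rw [InDisk, ← Affine.Simplex.convexHull_eq_closedInterior, disk]
  refine convexHull_min ?_ (convex_ball 0 1)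
  rintro _ ⟨i, rfl⟩
  simpa using h i

/-- The copy of `T` scaled by `t` about `c`, with `c` moved to the origin. -/
noncomputable def scaleAbout (T : Affine.Triangle ℝ ℂ) (c : ℂ) {t : ℝ} (ht : t ≠ 0) :
    Affine.Triangle ℝ ℂ :=
  T.map (t • (AffineMap.id ℝ ℂ - AffineMap.const ℝ ℂ c)) fun x y h => by
    simpa [ht] using h

theorem scaleAbout_points (T : Affine.Triangle ℝ ℂ) (c : ℂ) {t : ℝ} (ht : t ≠ 0) (i : Fin 3) :
    (scaleAbout T c ht).points i = t • (T.points i - c) := rfl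

theorem dist_scaleAbout (T : Affine.Triangle ℝ ℂ) (c : ℂ) {t : ℝ} (ht : 0 < t) (i j : Fin 3) :
    dist ((scaleAbout T c ht.ne').points i) ((scaleAbout T c ht.ne').points j) =
      t * dist (T.points i) (T.points j) := by
  rw [scaleAbout_points, scaleAbout_points, dist_smul₀, dist_sub_right, Real.norm_of_nonneg ht.le]

end BarBilliard

theorem theorem5p1 (T : Affine.Triangle ℝ ℂ) :
    ∃ T' : Affine.Triangle ℝ ℂ,
      BarBilliard.InDisk T' ∧ Similar T'.points T.points ∧
        ∀ A : Affine.Triangle ℝ ℂ, BarBilliard.InDisk A → Congruent A.points T'.points →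
          BarBilliard.rotationNumber (BarBilliard.psi A) = 1 / 3 := by
  obtain ⟨i, j, k, hij, hik, hjk, hijk, h1, h2⟩ := BarBilliard.exists_longest_side T
  obtain ⟨a, s, x, y, ℓ, c, ha, hs, has, hy, hx, hxy, hxy', hℓ, hpq, hpr, hqr, hpc, hqc, hrc⟩ :=
    BarBilliard.exists_shape (BarBilliard.cross_ne_zero T hij hik hjk) h1 h2
  obtain ⟨ρ, hρ0, hρ1, hρ⟩ := BarBilliard.exists_radius ha hs has hy hx hxy hxy'
  have ht : 0 < ρ / ℓ := div_pos hρ0 hℓ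
  -- The enclosing circle becomes the one of radius `ρ` about the origin, which lies in the disk.
  refine ⟨BarBilliard.scaleAbout T c ht.ne', ?_, ?_, ?_⟩
  · refine BarBilliard.inDisk_of_norm_lt fun l => ?_
    have hl : ‖T.points l - c‖ ≤ ℓ := by rcases hijk l with rfl | rfl | rfl <;> assumption
    rw [BarBilliard.scaleAbout_points, norm_smul, Real.norm_of_nonneg ht.le]
    calc ρ / ℓ * ‖T.points l - c‖ ≤ ρ / ℓ * ℓ := by gcongr
      _ = ρ := div_mul_cancel₀ _ hℓ.ne'
      _ < 1 := hρ1
  · exact similar_iff_exists_pos_dist_eq.2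
      ⟨ρ / ℓ, ht, fun l n => BarBilliard.dist_scaleAbout T c ht l n⟩
  · intro A hA hcong
    have hd : ∀ l n, ‖A.points l - A.points n‖ = ρ / ℓ * ‖T.points l - T.points n‖ := by
      intro l n
      rw [← dist_eq_norm, ← dist_eq_norm, congruent_iff_dist_eq.1 hcong,
        BarBilliard.dist_scaleAbout T c ht]
    obtain ⟨u, m, hu, hp, hq, hr | hr⟩ := BarBilliard.exists_frame (p := A.points i)
      (q := A.points j) (r := A.points k) (A := ρ * a) (X := ρ * x) (Y := ρ * y) (by positivity)
      (by rw [hd, hpq]; field_simp) (by rw [hd, mul_pow, hpr]; field_simp)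
      (by rw [hd, mul_pow, hqr]; field_simp)
    · refine hρ A hA i j k hijk u (m + ρ * s * Complex.I) x hu rfl ?_ ?_ ?_
      · rw [hp]; push_cast; ring
      · rw [hq]; push_cast; ring
      · rw [hr]; push_cast; ring
    -- In the mirror-image case a half turn of the frame and an exchange of the base vertices put
    -- the third vertex above the base again, with `x` replaced by `-x`.
    · refine hρ A hA j i k (fun l => by have := hijk l; tauto) (-u) (-m + ρ * s * Complex.I) (-x)
        (by rwa [norm_neg]) (abs_neg x) ?_ ?_ ?_
      · rw [hq]; push_cast; ring
      · rw [hp]; push_cast; ring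
      · rw [hr]; push_cast; ring
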